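/- Let $\mathfrak g$ be a finite-dimensional simple Lie algebra over $\mathbb C$ with Cartan subalgebra $\mathfrak h$, simple roots $\alpha_1,\dots,\alpha_r$, and Weyl group $W$ generated by the simple reflections $s_1,\dots,s_r$, with length function $\ell$. Let $\rho$ be half the sum of the positive roots, and for $\xi\in\mathfrak h^*$ let $\wp(\xi)$ be the number of ways to write $\xi$ as a linear combination of the positive roots with nonnegative integer coefficients. For $\lambda,\mu\in\mathfrak h^*$ put $$\mathcal A(\lambda,\mu)=\{\sigma\in W : \wp(\sigma(\lambda+\rho)-\mu-\rho)>0\}.$$ The influence $I(\sigma)$ of $\sigma\in W$ is the set of all $i$ such that $s_i$ occurs in a reduced word for $\sigma$; the extended influence $\overline I(\sigma)$ consists of $I(\sigma)$ and all $i$ adjacent in the Dynkin diagram to some $j\in I(\sigma)$. The influence is connected if it induces a connected (in particular nonempty) subgraph of the Dynkin diagram. Elements $\sigma,\tau\in W$ are independent if $I(\sigma)\cap\overline I(\tau)=\emptyset$, and a subset of $W$ is pairwise independent if any two distinct elements of it are independent. For $\lambda$ dominant integral and $\mathcal A(\lambda,\mu)\neq\emptyset$, $\mathrm{BAS}(\lambda,\mu)$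 denotes the unique subset $T\subseteq\mathcal A(\lambda,\mu)$ with $1\notin T$ such that every element of $T$ has connected influence and every element of $\mathcal A(\lambda,\mu)$ is the product of the elements of some (possibly empty) pairwise independent subset of $T$. Let $\lambda$ be a dominant integral weight and $\mu\in\mathfrak h^*$ a weight with $\mathcal A(\lambda,\mu)\neq\emptyset$. Let $S\subseteq\mathcal A(\lambda,\mu)$ with $1\notin S$ be such that (C1) every simple reflection $s_i\in\mathcal A(\lambda,\mu)$ lies in $S$; (C2) every $\sigma\in S$ has connected influence; (C3) for all (not necessarily distinct) $\sigma,\tau\in S$ that are not independent, at least one of the following holds: (1) $\sigma\tau\in S$; (2) $\sigma\tau=\nu_1\nu_2\cdots\nu_m$ with $m\ge 0$, where $\nu_1,\dots,\nu_m$ are distinct, $\{\nu_1,\dots,\nu_m\}\subseteq S$ is pairwise independent, and $\ell(\nu_1)+\cdots+\ell(\nu_m)<\ell(\sigma)+\ell(\tau)$; (3) some reduced word for the element $\sigma\tau$, or some concatenation of a reduced word for $\sigma$ with a reduced word for $\tau$, has a consecutive subword that represents an element of $W$ not in $\mathcal A(\lambda,\mu)$. Then there is exactly one set $T$ as in the definition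 of $\mathrm{BAS}(\lambda,\mu)$, and $\mathrm{BAS}(\lambda,\mu)=S$. -/

import Mathlib

/-!
Weyl alternation sets and basic allowable subwords, for a root pairing `P` with a base `b`.
`P.weylGroup` is the Weyl group `W`, acting on the space `M` of weights; simple roots are indexed
by the type `b.support`, and `b.IsPos i` says that the root with index `i` is positive.
-/

noncomputable section

namespace WeylAlternation

section Weights

variable {ι R M N : Type*} [Finite ι] [Field R] [CharZero R]
  [AddCommGroup M] [Module R M] [AddCommGroup N] [Module R N]
  {P : RootPairing ι R M N} [P.IsCrystallographic] [P.IsReduced] (b : P.Base)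

/-- `x` is a dominant integral weight: `⟨x, α^∨⟩ = 2 (x, α) / (α, α)` is an integer for every root
`α`, and it is nonnegative for every positive root `α`. -/
def IsDominantIntegral (x : M) : Prop :=
  (∀ i, ∃ n : ℤ, P.toLinearMap x (P.coroot i) = n) ∧
    ∀ i, b.IsPos i → ∃ n : ℕ, P.toLinearMap x (P.coroot i) = n

/-- `ρ`, half the sum of the positive roots. -/
def rho : M := (2 : R)⁻¹ • ∑ᶠ i : {i : ι // b.IsPos i}, P.root i

/-- Kostant's partition function: the number of ways to write `ξ` as a linear combination of the
positive roots with nonnegative integer coefficients. -/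
def kostantPartition (ξ : M) : ℕ∞ :=
  Set.encard {c : {i : ι // b.IsPos i} →₀ ℕ | (c.sum fun i n ↦ n • P.root i) = ξ}

/-- The Weyl alternation set `A(x, y)`. -/
def alternationSet (x y : M) : Set P.weylGroup :=
  {σ | 0 < kostantPartition b (σ • (x + rho b) - y - rho b)}

end Weights

section Words

variable {ι R M N : Type*} [CommRing R] [AddCommGroup M] [Module R M] [AddCommGroup N] [Module R N]
  {P : RootPairing ι R M N} (b : P.Base)

/-- The simple reflection `s_i`, as an element of the Weyl group. -/
def simpleReflection (i : b.support) : P.weylGroup :=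
  RootPairing.weylGroup.ofIdx P i

/-- The element of the Weyl group that a word in the simple reflections represents. -/
def wordProd (w : List b.support) : P.weylGroup :=
  (w.map (simpleReflection b)).prod

/-- The length `ℓ(σ)`: the least number of simple reflections whose product is `σ`. -/
def length (σ : P.weylGroup) : ℕ :=
  sInf {n | ∃ w : List b.support, wordProd b w = σ ∧ w.length = n}

/-- `w` is a reduced word for `σ`. -/
def IsReducedWord (w : List b.support) (σ : P.weylGroup) : Prop :=
  wordProd b w = σ ∧ w.length = length b σ

/-- The Dynkin diagram, as a simple graph on the simple roots: distinct simple roots are adjacent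
when they are not orthogonal. -/
def dynkinGraph : SimpleGraph b.support where
  Adj i j := i ≠ j ∧ ¬ P.IsOrthogonal i j
  symm := ⟨fun _ _ h ↦ ⟨h.1.symm, fun h' ↦ h.2 h'.symm⟩⟩
  loopless := ⟨fun _ h ↦ h.1 rfl⟩

/-- The influence `I(σ)`. -/
def influence (σ : P.weylGroup) : Set b.support :=
  {i | ∃ w, IsReducedWord b w σ ∧ i ∈ w}

/-- The extended influence of `σ`. -/
def extendedInfluence (σ : P.weylGroup) : Set b.support :=
  {i | i ∈ influence b σ ∨ ∃ j ∈ influence b σ, (dynkinGraph b).Adj i j}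

/-- The influence of `σ` induces a connected subgraph of the Dynkin diagram. -/
def HasConnectedInfluence (σ : P.weylGroup) : Prop :=
  ((dynkinGraph b).induce (influence b σ)).Connected

/-- `σ` and `τ` are independent. -/
def Independent (σ τ : P.weylGroup) : Prop :=
  influence b σ ∩ extendedInfluence b τ = ∅

/-- Any two distinct elements of `T` are independent. -/
def PairwiseIndependent (T : Set P.weylGroup) : Prop :=
  T.Pairwise (Independent b)

/-- The list `l` enumerates, without repetition, a (finite, possibly empty) pairwise independent
subset of `S` whose product is `σ`. -/
def IsIndependentProduct (S : Set P.weylGroup) (l : List P.weylGroup) (σ : P.weylGroup) : Prop :=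
  l.Nodup ∧ (∀ ν ∈ l, ν ∈ S) ∧ PairwiseIndependent b {ν | ν ∈ l} ∧ l.prod = σ

/-- `w` is a word for the product `σ τ`: either a reduced word for the element `σ τ`, or a reduced
word for `σ` followed by a reduced word for `τ` (which together need not be reduced). -/
def IsProductWord (w : List b.support) (σ τ : P.weylGroup) : Prop :=
  IsReducedWord b w (σ * τ) ∨
    ∃ u v, IsReducedWord b u σ ∧ IsReducedWord b v τ ∧ w = u ++ v

/-- The product `σ τ` contains a word not in `A` as a consecutive subword. -/
def ProductHasSubwordOutside (A : Set P.weylGroup) (σ τ : P.weylGroup) : Prop :=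
  ∃ w, IsProductWord b w σ τ ∧ ∃ u, u <:+: w ∧ wordProd b u ∉ A

end Words

section BAS

variable {ι R M N : Type*} [Finite ι] [Field R] [CharZero R]
  [AddCommGroup M] [Module R M] [AddCommGroup N] [Module R N]
  {P : RootPairing ι R M N} [P.IsCrystallographic] [P.IsReduced] (b : P.Base)

/-- The property that characterizes the set of basic allowable subwords. -/
structure IsBAS (x y : M) (S : Set P.weylGroup) : Prop where
  subset : S ⊆ alternationSet b x y
  one_notMem : 1 ∉ S
  connected : ∀ σ ∈ S, HasConnectedInfluence b σ
  exists_prod : ∀ σ ∈ alternationSet b x y, ∃ l, IsIndependentProduct b S l σ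

/-- `BAS(x, y)`: the set with the property `IsBAS` (meaningful when exactly one set has it). -/
def BAS (x y : M) : Set P.weylGroup :=
  Classical.epsilon (IsBAS b x y)

end BAS

end WeylAlternation

end

/-!
The argument works for the Weyl group of any finite reduced crystallographic root system with a
base. Write `A` for the alternation set.

If a positive root `β` stays positive under `σ`, then `σ(λ + ρ)` exceeds `σ s_β (λ + ρ)` by a
natural multiple of `σ β`, since `λ + ρ` pairs to a natural number with every positive coroot. Hence
membership in `A` passes from `σ s_β` to `σ` (`mem_alternationSet_of_mul_ofIdx`). With the exchange
property this makes `A` closed under consecutive subwords of reduced words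
(`IsReducedWord.wordProd_mem_alternationSet`).

Existence. A reduced word for `σ ∈ A` is a factorization of `σ` over `S` whose lengths add up to
`ℓ(σ)`. If two factors are dependent, independent factors between them commute out of the way, and
two dependent factors `σ₁`, `σ₂` become adjacent. Every word for `σ₁ σ₂` that the condition on
dependent pairs allows is then a consecutive subword of a reduced word for `σ`, so it has no subword
outside `A`; a product of smaller total length would contradict the additivity of lengths; so
`σ₁ σ₂ ∈ S`, which gives a factorization with fewer factors. A shortest factorization is therefore
pairwise independent (`exists_isIndependentProduct_of_factorization`).

Uniqueness. A reduced word for `σ` exhibits `ω_i - σ ω_i` as a sum of positive roots, one for each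
occurrence of `s_i`, so the influence of `σ` consists of the `i` for which `σ` moves the fundamental
weight `ω_i` (`mem_influence_iff`). Consequently the influence of an independent product is the
union of the influences of its factors, and it is disconnected when there are two nontrivial
factors. So an element of connected influence that is an independent product over `T` lies in `T`
(`IsIndependentProduct.mem_of_hasConnectedInfluence`), and two sets with the property `IsBAS` contain
each other.
-/

noncomputable section

namespace WeylAlternation

open RootPairing Function Set

/-! ### The Weyl group as a Coxeter group -/

section Reflections

variable {ι R M N : Type*} [CommRing R] [AddCommGroup M] [Module R M] [AddCommGroup N] [Module R N]
  {P : RootPairing ι R M N}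

lemma weylGroup_ext {g h : P.weylGroup} (H : ∀ x : M, g • x = h • x) : g = h :=
  Subtype.ext (Equiv.weightHom_injective P (LinearEquiv.ext H))

lemma root_smul (g : P.weylGroup) (i : ι) : P.root (g • i) = g • P.root i :=
  Equiv.root_indexEquiv_eq_smul (P := P) i g.1

lemma weylGroup_smul_smul (g : P.weylGroup) (r : R) (x : M) : g • (r • x) = r • (g • x) :=
  map_smul (Equiv.weightHom P g.1) r x

lemma ofIdx_smul_eq (i : ι) (x : M) : weylGroup.ofIdx P i • x = P.reflection i x := rfl

lemma ofIdx_smul_index (i j : ι) : weylGroup.ofIdx P i • j = P.reflectionPerm i j := rfl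

@[simp]
lemma ofIdx_mul_self (i : ι) : weylGroup.ofIdx P i * weylGroup.ofIdx P i = 1 :=
  weylGroup_ext fun x ↦ by simp [mul_smul]

@[simp]
lemma ofIdx_inv (i : ι) : (weylGroup.ofIdx P i)⁻¹ = weylGroup.ofIdx P i :=
  inv_eq_of_mul_eq_one_left (ofIdx_mul_self i)

lemma ofIdx_index_smul (g : P.weylGroup) (i : ι) :
    weylGroup.ofIdx P (g • i) = g * weylGroup.ofIdx P i * g⁻¹ := by
  obtain ⟨g, hg⟩ := g
  induction hg using weylGroup.induction generalizing i with
  | mem j =>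
    change weylGroup.ofIdx P (weylGroup.ofIdx P j • i) =
      weylGroup.ofIdx P j * weylGroup.ofIdx P i * (weylGroup.ofIdx P j)⁻¹
    refine weylGroup_ext fun x ↦ ?_
    simp [mul_smul, ofIdx_smul_index, reflection_reflectionPerm]
  | one =>
    change weylGroup.ofIdx P ((1 : P.weylGroup) • i) = 1 * weylGroup.ofIdx P i * 1⁻¹
    simp
  | mul x y hx hy hx' hy' =>
    change weylGroup.ofIdx P (((⟨x, hx⟩ : P.weylGroup) * ⟨y, hy⟩) • i) =
      ((⟨x, hx⟩ : P.weylGroup) * ⟨y, hy⟩) * weylGroup.ofIdx P i *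
        ((⟨x, hx⟩ : P.weylGroup) * ⟨y, hy⟩)⁻¹
    rw [mul_smul, hx', hy']
    group

lemma commute_ofIdx {i j : ι} (h : P.IsOrthogonal i j) :
    Commute (weylGroup.ofIdx P i) (weylGroup.ofIdx P j) :=
  weylGroup_ext fun x ↦ by
    simpa [mul_smul, ofIdx_smul_eq] using LinearEquiv.congr_fun (P.isOrthogonal_comm i j h).eq x

end Reflections

section Words

variable {ι R M N : Type*} [CommRing R] [AddCommGroup M] [Module R M] [AddCommGroup N] [Module R N]
  {P : RootPairing ι R M N} (b : P.Base)

@[simp] lemma wordProd_nil : wordProd b [] = 1 := rfl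

@[simp] lemma wordProd_cons (i : b.support) (w : List b.support) :
    wordProd b (i :: w) = simpleReflection b i * wordProd b w := by
  simp [wordProd]

@[simp] lemma wordProd_append (u v : List b.support) :
    wordProd b (u ++ v) = wordProd b u * wordProd b v := by
  simp [wordProd]

lemma wordProd_singleton (i : b.support) : wordProd b [i] = simpleReflection b i := by simp

@[simp] lemma simpleReflection_mul_self (i : b.support) :
    simpleReflection b i * simpleReflection b i = 1 := ofIdx_mul_self _

@[simp] lemma simpleReflection_inv (i : b.support) :
    (simpleReflection b i)⁻¹ = simpleReflection b i := ofIdx_inv _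

lemma wordProd_reverse (w : List b.support) : wordProd b w.reverse = (wordProd b w)⁻¹ := by
  induction w with
  | nil => simp
  | cons i w ih => simp [ih]

variable {b} in
lemma length_wordProd_le (w : List b.support) : length b (wordProd b w) ≤ w.length :=
  Nat.sInf_le ⟨w, rfl, rfl⟩

/-- A word of length at most `ℓ(σ)` for `σ` is reduced. -/
lemma IsReducedWord.of_length_le {b : P.Base} {w : List b.support} {σ : P.weylGroup}
    (h : wordProd b w = σ) (hl : w.length ≤ length b σ) : IsReducedWord b w σ :=
  ⟨h, le_antisymm hl (h ▸ length_wordProd_le w)⟩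

end Words

section Finite

variable {ι R M N : Type*} [Finite ι] [Field R] [CharZero R]
  [AddCommGroup M] [Module R M] [AddCommGroup N] [Module R N]
  {P : RootPairing ι R M N} [P.IsCrystallographic] [P.IsReduced] (b : P.Base)

/-- The simple reflections generate the Weyl group: every root is conjugate to a simple root. -/
lemma exists_wordProd_eq (σ : P.weylGroup) : ∃ w : List b.support, wordProd b w = σ := by
  have key (i : ι) : ∃ w : List b.support, wordProd b w = weylGroup.ofIdx P i := by
    refine b.induction_reflect i
      (p := fun i ↦ ∃ w : List b.support, wordProd b w = weylGroup.ofIdx P i)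
      (fun i ⟨w, hw⟩ ↦ ⟨w, ?_⟩) (fun i hi ↦ ⟨[⟨i, hi⟩], ?_⟩)
      (fun i j ⟨w, hw⟩ hj ↦ ⟨[⟨j, hj⟩] ++ w ++ [⟨j, hj⟩], ?_⟩)
    · rw [← ofIdx_smul_index, ofIdx_index_smul, hw]
      simp
    · simp [simpleReflection]
    · rw [← ofIdx_smul_index, ofIdx_index_smul, wordProd_append, wordProd_append, hw]
      simp [simpleReflection]
  obtain ⟨σ, hσ⟩ := σ
  induction hσ using weylGroup.induction with
  | mem i => exact key i
  | one => exact ⟨[], rfl⟩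
  | mul x y hx hy hx' hy' =>
    obtain ⟨u, hu⟩ := hx'
    obtain ⟨v, hv⟩ := hy'
    exact ⟨u ++ v, by rw [wordProd_append, hu, hv]; rfl⟩

lemma exists_isReducedWord (σ : P.weylGroup) : ∃ w, IsReducedWord b w σ := by
  obtain ⟨w, hw⟩ := exists_wordProd_eq b σ
  exact Nat.sInf_mem (s := {n | ∃ w : List b.support, wordProd b w = σ ∧ w.length = n})
    ⟨_, w, hw, rfl⟩

lemma length_mul_le (σ τ : P.weylGroup) : length b (σ * τ) ≤ length b σ + length b τ := by
  obtain ⟨u, rfl, hu⟩ := exists_isReducedWord b σ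
  obtain ⟨v, rfl, hv⟩ := exists_isReducedWord b τ
  rw [← hu, ← hv, ← wordProd_append, ← List.length_append]
  exact length_wordProd_le _

lemma length_list_prod_le (l : List P.weylGroup) :
    length b l.prod ≤ (l.map (length b)).sum := by
  induction l with
  | nil => simpa using length_wordProd_le (b := b) []
  | cons σ l ih =>
    simp only [List.prod_cons, List.map_cons, List.sum_cons]
    exact (length_mul_le b _ _).trans (by lia)

variable {b}

lemma IsReducedWord.left {u v : List b.support} {σ : P.weylGroup}
    (h : IsReducedWord b (u ++ v) σ) : IsReducedWord b u (wordProd b u) := by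
  refine .of_length_le rfl ?_
  have h1 := h.2
  rw [← h.1, wordProd_append, List.length_append] at h1
  have := length_mul_le b (wordProd b u) (wordProd b v)
  have := length_wordProd_le v
  lia

lemma IsReducedWord.right {u v : List b.support} {σ : P.weylGroup}
    (h : IsReducedWord b (u ++ v) σ) : IsReducedWord b v (wordProd b v) := by
  refine .of_length_le rfl ?_
  have h1 := h.2
  rw [← h.1, wordProd_append, List.length_append] at h1
  have := length_mul_le b (wordProd b u) (wordProd b v)
  have := length_wordProd_le u
  lia

lemma length_inv (σ : P.weylGroup) : length b σ⁻¹ = length b σ := by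
  have key (σ : P.weylGroup) : length b σ⁻¹ ≤ length b σ := by
    obtain ⟨u, rfl, hu⟩ := exists_isReducedWord b σ
    rw [← hu, ← wordProd_reverse, ← List.length_reverse]
    exact length_wordProd_le _
  exact le_antisymm (key σ) (by simpa using key σ⁻¹)

lemma IsReducedWord.reverse {w : List b.support} {σ : P.weylGroup}
    (h : IsReducedWord b w σ) : IsReducedWord b w.reverse σ⁻¹ :=
  ⟨by rw [wordProd_reverse, h.1], by rw [List.length_reverse, length_inv, h.2]⟩

/-- A simple reflection makes only its own simple root negative. -/
lemma eq_of_isPos_of_not_isPos {i : ι} {j : b.support} (hi : b.IsPos i)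
    (h : ¬ b.IsPos (simpleReflection b j • i)) : i = j := by
  by_contra hij
  exact h (hi.reflectionPerm j.2 hij)

/-- The exchange property: if `σ` makes the simple root `α_i` negative, then a word for `σ s_i`
arises from any word for `σ` by deleting a letter. -/
lemma exists_wordProd_eq_mul_of_not_isPos (w : List b.support) (i : b.support)
    (h : ¬ b.IsPos (wordProd b w • (i : ι))) :
    ∃ w' : List b.support, w'.length + 1 = w.length ∧
      wordProd b w' = wordProd b w * simpleReflection b i := by
  induction w with
  | nil => exact absurd (Base.isPos_of_mem_support i.2) (by simpa using h)
  | cons j v ih =>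
    by_cases hv : b.IsPos (wordProd b v • (i : ι))
    · -- `v` sends `α_i` to `α_j`, so `s_j = v s_i v⁻¹` and the letter `j` cancels.
      rw [wordProd_cons, mul_smul] at h
      have hj := ofIdx_index_smul (wordProd b v) (i : ι)
      rw [eq_of_isPos_of_not_isPos hv h] at hj
      refine ⟨v, rfl, ?_⟩
      have hj' : simpleReflection b j = wordProd b v * simpleReflection b i * (wordProd b v)⁻¹ := hj
      rw [wordProd_cons, hj']
      simp [mul_assoc]
    · obtain ⟨v', h1, h2⟩ := ih hv
      exact ⟨j :: v', by simp [← h1], by simp [h2, mul_assoc]⟩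

lemma IsReducedWord.isPos {u : List b.support} {i : b.support} {σ : P.weylGroup}
    (h : IsReducedWord b (u ++ [i]) σ) : b.IsPos (wordProd b u • (i : ι)) := by
  by_contra hn
  obtain ⟨w, h1, h2⟩ := exists_wordProd_eq_mul_of_not_isPos u i hn
  have h3 : wordProd b w = σ := by rw [h2, ← h.1]; simp
  have h4 := h.2
  have h5 := length_wordProd_le w
  rw [h3] at h5
  simp only [List.length_append, List.length_singleton] at h4
  lia

lemma IsReducedWord.isPos_inv {u : List b.support} {i : b.support} {σ : P.weylGroup}
    (h : IsReducedWord b (i :: u) σ) : b.IsPos ((wordProd b u)⁻¹ • (i : ι)) := by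
  rw [← wordProd_reverse]
  refine IsReducedWord.isPos (σ := σ⁻¹) ?_
  simpa using h.reverse

end Finite

/-! ### Dominance and the alternation set -/

section Kostant

variable {ι R M N : Type*} [Field R] [CharZero R]
  [AddCommGroup M] [Module R M] [AddCommGroup N] [Module R N]
  {P : RootPairing ι R M N} {b : P.Base}

lemma mem_alternationSet_iff {x y : M} {σ : P.weylGroup} :
    σ ∈ alternationSet b x y ↔ σ • (x + rho b) - y - rho b ∈
      AddSubmonoid.closure (range fun i : {i : ι // b.IsPos i} ↦ P.root i) := by
  rw [AddSubmonoid.mem_closure_range_iff]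
  simp only [alternationSet, kostantPartition, mem_ofPred_eq, encard_pos, Set.Nonempty, eq_comm]

end Kostant

section Dominance

variable {ι R M N : Type*} [Finite ι] [Field R] [CharZero R]
  [AddCommGroup M] [Module R M] [AddCommGroup N] [Module R N]
  {P : RootPairing ι R M N} [P.IsCrystallographic] [P.IsReduced] (b : P.Base)

lemma isPos_reflectionPerm_iff {i j : ι} (hj : j ∈ b.support) (hij : i ≠ j)
    (hij' : P.reflectionPerm j i ≠ j) : b.IsPos (P.reflectionPerm j i) ↔ b.IsPos i := by
  refine ⟨fun h ↦ ?_, fun h ↦ h.reflectionPerm hj hij⟩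
  simpa [P.reflectionPerm_involutive j i] using h.reflectionPerm hj hij'

/-- A root is positive exactly when its coroot is. The equivalence is preserved by simple
reflections, because they permute the positive roots (and coroots) other than the simple one. -/
lemma isPos_flip_iff (i : ι) : b.flip.IsPos i ↔ b.IsPos i := by
  have : Module.IsTorsionFree R N := inferInstance
  let := P.indexNeg
  have hneg (i : ι) (h : b.flip.IsPos i ↔ b.IsPos i) :
      b.flip.IsPos (-i) ↔ b.IsPos (-i) := by
    have h1 := Base.IsPos.neg_iff_not b.flip i
    have h2 := Base.IsPos.neg_iff_not b i
    exact h1.trans ((not_congr h).trans h2.symm)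
  refine b.induction_reflect i (p := fun i ↦ b.flip.IsPos i ↔ b.IsPos i) hneg ?_ ?_
  · exact fun i hi ↦ iff_of_true (Base.isPos_of_mem_support (b := b.flip) hi)
      (Base.isPos_of_mem_support hi)
  · intro i j hi hj
    by_cases hij : i = j
    · subst hij
      exact hneg i hi
    by_cases hij' : P.reflectionPerm j i = j
    · rw [hij']
      exact iff_of_true (Base.isPos_of_mem_support (b := b.flip) hj) (Base.isPos_of_mem_support hj)
    · exact (isPos_reflectionPerm_iff b.flip hj hij hij').trans
        (hi.trans (isPos_reflectionPerm_iff b hj hij hij').symm)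

/-- A weight that pairs to natural numbers with the simple coroots does so with all positive coroots.
The induction on sums runs over roots of the flipped pairing, that is, over coroots. -/
lemma exists_nat_of_forall_simple {x : M}
    (h : ∀ i ∈ b.support, ∃ n : ℕ, P.toLinearMap x (P.coroot i) = n) {i : ι} (hi : b.IsPos i) :
    ∃ n : ℕ, P.toLinearMap x (P.coroot i) = n := by
  have hi' := (isPos_flip_iff b i).2 hi
  refine hi'.induction_on_add (p := fun i ↦ ∃ n : ℕ, P.toLinearMap x (P.coroot i) = n) h ?_
  rintro i j k hk ⟨n, hn⟩ hj
  obtain ⟨m, hm⟩ := h j hj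
  replace hk : P.coroot k = P.coroot i + P.coroot j := hk
  exact ⟨n + m, by rw [hk, map_add, hn, hm, Nat.cast_add]⟩

/-- The simple reflection `s_i` permutes the positive roots other than `α_i`, so the sum of these is
orthogonal to the simple coroot. -/
lemma rho_apply_coroot (i : b.support) : P.toLinearMap (rho b) (P.coroot i) = 1 := by
  classical
  have := Fintype.ofFinite ι
  let s : Finset ι := {j | b.IsPos j}
  have hi : (i : ι) ∈ s := by simpa [s] using Base.isPos_of_mem_support i.2
  have hsum : ∑ᶠ j : {j : ι // b.IsPos j}, P.root j = P.root i + ∑ j ∈ s.erase i, P.root j := by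
    rw [finsum_eq_sum_of_fintype, Finset.add_sum_erase s (fun j ↦ P.root j) hi]
    exact (Finset.sum_subtype s (by simp [s]) (fun j ↦ P.root j)).symm
  have hrefl : P.reflection i (∑ j ∈ s.erase i, P.root j) = ∑ j ∈ s.erase i, P.root j := by
    have hmem (j : ι) (hj : j ∈ s.erase i) : P.reflectionPerm i j ∈ s.erase i := by
      simp only [s, Finset.mem_erase, Finset.mem_filter, Finset.mem_univ, true_and] at hj ⊢
      refine ⟨fun h ↦ ?_, hj.2.reflectionPerm i.2 hj.1⟩
      have h' : P.reflectionPerm i i = j := by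
        nth_rw 2 [← h]; exact P.reflectionPerm_involutive i j
      have := Base.height_reflectionPerm_self b (i : ι)
      have hpos := b.isPos_iff.1 hj.2
      rw [← h', show b.height (P.reflectionPerm i i) = _ from this,
        Base.height_one_of_mem_support i.2] at hpos
      lia
    rw [map_sum]
    exact Finset.sum_nbij' (P.reflectionPerm i) (P.reflectionPerm i) hmem hmem
      (fun j _ ↦ P.reflectionPerm_involutive i j) (fun j _ ↦ P.reflectionPerm_involutive i j)
      (fun j _ ↦ (P.root_reflectionPerm i j).symm)
  rw [reflection_apply, sub_eq_self, smul_eq_zero_iff_left (P.ne_zero _)] at hrefl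
  replace hrefl : P.toLinearMap (∑ j ∈ s.erase i, P.root j) (P.coroot i) = 0 := hrefl
  rw [rho, hsum, map_smul, map_add, LinearMap.smul_apply, LinearMap.add_apply, hrefl,
    root_coroot_two, add_zero, smul_eq_mul, inv_mul_cancel₀ two_ne_zero]

variable {b} in
/-- `λ + ρ` pairs to a natural number with every positive coroot if `λ` is dominant integral. -/
lemma IsDominantIntegral.exists_nat_add_rho {x : M} (hx : IsDominantIntegral b x) {i : ι}
    (hi : b.IsPos i) : ∃ n : ℕ, P.toLinearMap (x + rho b) (P.coroot i) = n := by
  refine exists_nat_of_forall_simple b (fun i hi ↦ ?_) hi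
  obtain ⟨n, hn⟩ := hx.2 i (Base.isPos_of_mem_support hi)
  refine ⟨n + 1, ?_⟩
  rw [map_add, LinearMap.add_apply, hn, rho_apply_coroot b ⟨i, hi⟩, Nat.cast_add, Nat.cast_one]

variable {b} {x y : M}

/-- If `σ` sends a positive root `β` to a positive root, then `σ(λ + ρ)` exceeds `σ s_β (λ + ρ)` by
a natural multiple of `σ β`. -/
lemma mem_alternationSet_of_mul_ofIdx (hx : IsDominantIntegral b x) {σ : P.weylGroup} {i : ι}
    (hi : b.IsPos i) (hσi : b.IsPos (σ • i))
    (h : σ * weylGroup.ofIdx P i ∈ alternationSet b x y) : σ ∈ alternationSet b x y := by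
  rw [mem_alternationSet_iff] at h ⊢
  obtain ⟨n, hn⟩ := hx.exists_nat_add_rho hi
  have h1 : P.reflection i (x + rho b) = (x + rho b) - n • P.root i := by
    rw [reflection_apply, ← Nat.cast_smul_eq_nsmul R, ← hn]
    rfl
  have h2 : σ • (x + rho b) - y - rho b =
      ((σ * weylGroup.ofIdx P i) • (x + rho b) - y - rho b) + n • P.root (σ • i) := by
    rw [mul_smul, ofIdx_smul_eq, h1, smul_sub, root_smul, ← Nat.cast_smul_eq_nsmul R,
      ← Nat.cast_smul_eq_nsmul R, weylGroup_smul_smul]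
    abel
  rw [h2]
  exact add_mem h <| nsmul_mem (AddSubmonoid.subset_closure <|
    mem_range_self (⟨σ • i, hσi⟩ : {i : ι // b.IsPos i})) n

/-- The alternation set is closed under consecutive subwords of reduced words. -/
lemma IsReducedWord.wordProd_mem_alternationSet (hx : IsDominantIntegral b x)
    {w u : List b.support} {σ : P.weylGroup} (hw : IsReducedWord b w σ)
    (hσ : σ ∈ alternationSet b x y) (hu : u <:+: w) : wordProd b u ∈ alternationSet b x y := by
  obtain ⟨p, q, rfl⟩ := hu
  obtain rfl := hw.1
  induction q using List.reverseRecOn with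
  | append_singleton q i ih =>
    rw [← List.append_assoc] at hw hσ
    refine ih ?_ hw.left
    refine mem_alternationSet_of_mul_ofIdx hx (Base.isPos_of_mem_support i.2) hw.isPos ?_
    simpa [simpleReflection, mul_assoc] using hσ
  | nil =>
    rw [List.append_nil] at hw hσ
    induction p with
    | nil => simpa using hσ
    | cons i p ih =>
      rw [List.cons_append] at hw hσ
      refine ih ?_ (IsReducedWord.right (u := [i]) hw)
      refine mem_alternationSet_of_mul_ofIdx hx hw.isPos_inv
        (by simpa only [smul_inv_smul] using Base.isPos_of_mem_support i.2) ?_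
      rw [ofIdx_index_smul]
      simpa [simpleReflection, mul_assoc] using hσ

end Dominance

/-! ### Independent elements -/

section Independence

variable {ι R M N : Type*} [CommRing R] [AddCommGroup M] [Module R M] [AddCommGroup N] [Module R N]
  {P : RootPairing ι R M N} {b : P.Base}

lemma independent_iff {σ τ : P.weylGroup} :
    Independent b σ τ ↔
      ∀ i ∈ influence b σ, ∀ j ∈ influence b τ, i ≠ j ∧ ¬ (dynkinGraph b).Adj i j := by
  simp only [Independent, eq_empty_iff_forall_notMem]
  refine ⟨fun h i hi j hj ↦ ⟨?_, fun hij ↦ h i ⟨hi, Or.inr ⟨j, hj, hij⟩⟩⟩, ?_⟩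
  · rintro rfl
    exact h i ⟨hi, Or.inl hj⟩
  · rintro h i ⟨hi, hi' | ⟨j, hj, hij⟩⟩
    · exact (h i hi i hi').1 rfl
    · exact (h i hi j hj).2 hij

lemma Independent.symm {σ τ : P.weylGroup} (h : Independent b σ τ) : Independent b τ σ := by
  rw [independent_iff] at h ⊢
  exact fun i hi j hj ↦ ⟨(h j hj i hi).1.symm, fun hij ↦ (h j hj i hi).2 hij.symm⟩

instance : Std.Symm (Independent b) := ⟨fun _ _ ↦ Independent.symm⟩

lemma HasConnectedInfluence.nonempty {σ : P.weylGroup} (h : HasConnectedInfluence b σ) :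
    (influence b σ).Nonempty :=
  let ⟨i⟩ := SimpleGraph.Connected.nonempty h
  ⟨i, i.2⟩

lemma HasConnectedInfluence.not_independent_self {σ : P.weylGroup}
    (h : HasConnectedInfluence b σ) : ¬ Independent b σ σ := by
  obtain ⟨i, hi⟩ := h.nonempty
  exact fun hσ ↦ (independent_iff.1 hσ i hi i hi).1 rfl

/-- A list with two dependent entries can be permuted, without changing its product, so that two
dependent entries become adjacent: the head commutes with the entries before the first one that
depends on it. -/
lemma exists_perm_adjacent_of_not_pairwise {l : List P.weylGroup}
    (hcomm : ∀ σ τ : P.weylGroup, Independent b σ τ → Commute σ τ)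
    (h : ¬ l.Pairwise (Independent b)) :
    ∃ p σ τ q, ¬ Independent b σ τ ∧ (p ++ σ :: τ :: q).Perm l ∧
      (p ++ σ :: τ :: q).prod = l.prod := by
  induction l with
  | nil => simp at h
  | cons σ l ih =>
    by_cases hl : l.Pairwise (Independent b)
    · have hex : ∃ τ ∈ l, ¬ Independent b σ τ := by
        by_contra! hn
        exact h (List.pairwise_cons.2 ⟨hn, hl⟩)
      clear ih h hl
      suffices ∃ p τ q, ¬ Independent b σ τ ∧ (∀ ν ∈ p, Independent b σ ν) ∧ l = p ++ τ :: q by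
        obtain ⟨p, τ, q, hστ, hp, rfl⟩ := this
        refine ⟨p, σ, τ, q, hστ, List.perm_middle, ?_⟩
        have : Commute σ p.prod := Commute.list_prod_right _ _ fun ν hν ↦ hcomm _ _ (hp ν hν)
        simp only [List.prod_append, List.prod_cons]
        rw [← mul_assoc, ← this.eq]
        simp only [mul_assoc]
      induction l with
      | nil => simp at hex
      | cons ν l ih =>
        by_cases hν : Independent b σ ν
        · obtain ⟨p, τ, q, h1, h2, rfl⟩ := ih (by simpa [hν] using hex)
          exact ⟨ν :: p, τ, q, h1, by simpa [hν] using h2, rfl⟩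
        · exact ⟨[], ν, l, hν, by simp, rfl⟩
    · obtain ⟨p, ν, τ, q, h1, h2, h3⟩ := ih hl
      exact ⟨σ :: p, ν, τ, q, h1, h2.cons σ, by
        rw [List.cons_append, List.prod_cons, h3, List.prod_cons]⟩

end Independence

section Commutation

variable {ι R M N : Type*} [Finite ι] [Field R] [CharZero R]
  [AddCommGroup M] [Module R M] [AddCommGroup N] [Module R N]
  {P : RootPairing ι R M N} [P.IsCrystallographic] [P.IsReduced] {b : P.Base}

lemma Independent.commute {σ τ : P.weylGroup} (h : Independent b σ τ) : Commute σ τ := by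
  rw [independent_iff] at h
  obtain ⟨u, hu⟩ := exists_isReducedWord b σ
  obtain ⟨v, hv⟩ := exists_isReducedWord b τ
  rw [← hu.1, ← hv.1]
  refine Commute.list_prod_left _ _ fun x hx ↦ Commute.list_prod_right _ _ fun y hy ↦ ?_
  obtain ⟨i, hi, rfl⟩ := List.mem_map.1 hx
  obtain ⟨j, hj, rfl⟩ := List.mem_map.1 hy
  have hij := h i ⟨u, hu, hi⟩ j ⟨v, hv, hj⟩
  refine commute_ofIdx ?_
  by_contra hn
  exact hij.2 ⟨hij.1, hn⟩

/-- Every list of Weyl group elements is represented by a word of the total length. -/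
lemma exists_word_of_list (b : P.Base) (l : List P.weylGroup) :
    ∃ w : List b.support, wordProd b w = l.prod ∧ w.length = (l.map (length b)).sum := by
  induction l with
  | nil => exact ⟨[], rfl, rfl⟩
  | cons σ l ih =>
    obtain ⟨v, hv, hvl⟩ := ih
    obtain ⟨u, hu, hul⟩ := exists_isReducedWord b σ
    exact ⟨u ++ v, by simp [hu, hv], by simp [hul, hvl]⟩

variable {x y : M} {S : Set P.weylGroup}

/-- Two adjacent factors in a length-additive factorization of an element of the alternation set
cannot have a product with a subword outside the alternation set. -/
lemma not_productHasSubwordOutside (hx : IsDominantIntegral b x) {p q : List P.weylGroup}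
    {σ τ : P.weylGroup} (hmem : (p ++ σ :: τ :: q).prod ∈ alternationSet b x y)
    (hlen : ((p ++ σ :: τ :: q).map (length b)).sum ≤ length b (p ++ σ :: τ :: q).prod) :
    ¬ ProductHasSubwordOutside b (alternationSet b x y) σ τ := by
  rintro ⟨w, hw, u, hu, hnot⟩
  obtain ⟨wp, hp, hpl⟩ := exists_word_of_list b p
  obtain ⟨wq, hq, hql⟩ := exists_word_of_list b q
  have hw1 : wordProd b w = σ * τ ∧ w.length ≤ length b σ + length b τ := by
    rcases hw with hw | ⟨s, t, hs, ht, rfl⟩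
    · exact ⟨hw.1, hw.2 ▸ length_mul_le b σ τ⟩
    · exact ⟨by rw [wordProd_append, hs.1, ht.1], by rw [List.length_append, hs.2, ht.2]⟩
  have hred : IsReducedWord b (wp ++ w ++ wq) (p ++ σ :: τ :: q).prod := by
    refine .of_length_le (by simp [hp, hq, hw1.1, mul_assoc]) (le_trans ?_ hlen)
    have := hw1.2
    simp only [List.length_append, List.map_append, List.map_cons, List.sum_append, List.sum_cons]
    lia
  exact hnot <| hred.wordProd_mem_alternationSet hx hmem <|
    hu.trans (List.infix_append wp w wq)

/-- Under the closure condition on dependent pairs, a length-additive factorization over `S` can be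
shortened until its factors are pairwise independent. -/
lemma exists_isIndependentProduct_of_factorization (hx : IsDominantIntegral b x)
    (hC2 : ∀ σ ∈ S, HasConnectedInfluence b σ)
    (hC3 : ∀ σ ∈ S, ∀ τ ∈ S, ¬ Independent b σ τ →
      σ * τ ∈ S ∨
      (∃ l, IsIndependentProduct b S l (σ * τ) ∧
        (l.map (length b)).sum < length b σ + length b τ) ∨
      ProductHasSubwordOutside b (alternationSet b x y) σ τ)
    (l : List P.weylGroup) (hlS : ∀ ν ∈ l, ν ∈ S) (hmem : l.prod ∈ alternationSet b x y)
    (hlen : (l.map (length b)).sum ≤ length b l.prod) :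
    ∃ l', IsIndependentProduct b S l' l.prod := by
  induction hn : l.length using Nat.strong_induction_on generalizing l with
  | _ n ih =>
    by_cases hl : l.Pairwise (Independent b)
    · refine ⟨l, hl.imp_of_mem fun {σ τ} hσ _ hστ ↦ ?_, hlS, fun σ hσ τ hτ hne ↦ ?_, rfl⟩
      · rintro rfl
        exact (hC2 σ (hlS σ hσ)).not_independent_self hστ
      · exact hl.forall hσ hτ hne
    · obtain ⟨p, σ, τ, q, hdep, hperm, hprod⟩ :=
        exists_perm_adjacent_of_not_pairwise (fun _ _ h ↦ h.commute) hl
      have hsum := (hperm.map (length b)).sum_eq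
      have hmemS (ν) (hν : ν ∈ p ++ σ :: τ :: q) : ν ∈ S := hlS ν (hperm.mem_iff.1 hν)
      rw [← hprod, ← hsum] at hlen
      rw [← hprod] at hmem ⊢
      have hlen' := hlen
      simp only [List.map_append, List.map_cons, List.sum_append, List.sum_cons,
        List.prod_append, List.prod_cons] at hlen'
      have h1 := length_mul_le b p.prod (σ * (τ * q.prod))
      have h2 := length_mul_le b (σ * τ) q.prod
      rw [mul_assoc] at h2
      have h3 := length_list_prod_le b p
      have h4 := length_list_prod_le b q
      rcases hC3 σ (hmemS σ (by simp)) τ (hmemS τ (by simp)) hdep with h | ⟨m, hm, hml⟩ | h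
      · have hprod' : (p ++ (σ * τ) :: q).prod = (p ++ σ :: τ :: q).prod := by simp [mul_assoc]
        rw [← hprod'] at hmem ⊢
        have h5 := length_mul_le b σ τ
        refine ih _ ?_ (p ++ (σ * τ) :: q) ?_ hmem ?_ rfl
        · rw [← hn, ← hperm.length_eq]
          simp
        · intro ν hν
          rcases List.mem_append.1 hν with hν | hν
          · exact hmemS ν (by simp [hν])
          · rcases List.mem_cons.1 hν with rfl | hν
            · exact h
            · exact hmemS ν (by simp [hν])
        · rw [hprod']
          refine le_trans ?_ hlen
          simp only [List.map_append, List.map_cons, List.sum_append, List.sum_cons]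
          lia
      · -- A shorter expression of `σ τ` would shorten a length-additive factorization.
        have h5 := length_list_prod_le b m
        rw [hm.2.2.2] at h5
        lia
      · exact absurd h (not_productHasSubwordOutside hx hmem hlen)

/-- Under the conditions on `S`, every element of the alternation set is an independent product over
`S`: its reduced words are factorizations over `S` to start from. -/
lemma exists_isIndependentProduct (hx : IsDominantIntegral b x)
    (hC1 : ∀ i : b.support, simpleReflection b i ∈ alternationSet b x y →
      simpleReflection b i ∈ S)
    (hC2 : ∀ σ ∈ S, HasConnectedInfluence b σ)
    (hC3 : ∀ σ ∈ S, ∀ τ ∈ S, ¬ Independent b σ τ →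
      σ * τ ∈ S ∨
      (∃ l, IsIndependentProduct b S l (σ * τ) ∧
        (l.map (length b)).sum < length b σ + length b τ) ∨
      ProductHasSubwordOutside b (alternationSet b x y) σ τ)
    {σ : P.weylGroup} (hσ : σ ∈ alternationSet b x y) :
    ∃ l, IsIndependentProduct b S l σ := by
  obtain ⟨w, hw⟩ := exists_isReducedWord b σ
  have hprod : (w.map (simpleReflection b)).prod = σ := hw.1
  rw [← hprod] at hσ ⊢
  refine exists_isIndependentProduct_of_factorization hx hC2 hC3 _ ?_ hσ ?_
  · intro ν hν
    obtain ⟨i, hi, rfl⟩ := List.mem_map.1 hν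
    refine hC1 i ?_
    rw [← wordProd_singleton]
    refine IsReducedWord.wordProd_mem_alternationSet hx hw (hprod ▸ hσ) ?_
    exact (List.singleton_infix_iff i w).2 hi
  · rw [hprod, ← hw.2, List.map_map]
    refine (List.sum_le_card_nsmul _ 1 fun n hn ↦ ?_).trans (by simp)
    obtain ⟨i, -, rfl⟩ := List.mem_map.1 hn
    simpa [wordProd_singleton] using length_wordProd_le (b := b) [i]

end Commutation

/-! ### Influence and fundamental weights -/

section FundamentalWeights

variable {ι R M N : Type*} [Field R]
  [AddCommGroup M] [Module R M] [AddCommGroup N] [Module R N]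
  {P : RootPairing ι R M N} [P.IsRootSystem] (b : P.Base)

/-- The fundamental weight dual to the simple coroot with index `i`. -/
def fundamentalWeight (i : b.support) : M :=
  P.toPerfPair.symm (b.toCoweightBasis.coord i)

open scoped Classical in
lemma fundamentalWeight_apply_coroot (i j : b.support) :
    P.toLinearMap (fundamentalWeight b i) (P.coroot j) = if j = i then 1 else 0 := by
  have : P.toLinearMap (fundamentalWeight b i) = b.toCoweightBasis.coord i :=
    P.toPerfPair.apply_symm_apply _
  rw [this, ← b.toCoweightBasis_apply, Module.Basis.coord_apply, Module.Basis.repr_self,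
    Finsupp.single_apply]

open scoped Classical in
lemma simpleReflection_smul_fundamentalWeight (i j : b.support) :
    simpleReflection b j • fundamentalWeight b i =
      fundamentalWeight b i - if j = i then P.root j else 0 := by
  have : simpleReflection b j • fundamentalWeight b i = fundamentalWeight b i -
      P.toLinearMap (fundamentalWeight b i) (P.coroot j) • P.root j := rfl
  rw [this, fundamentalWeight_apply_coroot]
  split_ifs <;> simp

/-- The linear form that takes the value `1` at each simple root. -/
def heightForm : M →ₗ[R] R := b.toWeightBasis.constr R fun _ ↦ (1 : R)

lemma heightForm_root [CharZero R] (i : ι) : heightForm b (P.root i) = b.height i := by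
  obtain ⟨f, -, -, hf⟩ := b.exists_root_eq_sum_int i
  rw [Base.height_eq_sum hf, hf, map_sum, Int.cast_sum]
  refine Finset.sum_congr rfl fun j hj ↦ ?_
  have : heightForm b (P.root j) = 1 := by
    rw [← b.toWeightBasis_apply ⟨j, hj⟩, heightForm, Module.Basis.constr_basis]
  rw [map_zsmul, this, zsmul_one]

variable {b}

lemma wordProd_smul_fundamentalWeight_of_notMem {i : b.support} {w : List b.support} (hw : i ∉ w) :
    wordProd b w • fundamentalWeight b i = fundamentalWeight b i := by
  induction w with
  | nil => simp
  | cons j w ih =>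
    simp only [List.mem_cons, not_or] at hw
    rw [wordProd_cons, mul_smul, ih hw.2, simpleReflection_smul_fundamentalWeight,
      if_neg (Ne.symm hw.1), sub_zero]

end FundamentalWeights

section Influence

variable {ι R M N : Type*} [Finite ι] [Field R] [CharZero R]
  [AddCommGroup M] [Module R M] [AddCommGroup N] [Module R N]
  {P : RootPairing ι R M N} [P.IsCrystallographic] [P.IsReduced] [P.IsRootSystem] {b : P.Base}

/-- For a reduced word `s_{i_1} ⋯ s_{i_k}` of `σ`, the weight `ω_i - σ ω_i` is the sum of the
positive roots `s_{i_1} ⋯ s_{i_{m-1}} α_i` over the positions `m` with `i_m = i`. -/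
lemma IsReducedWord.exists_heightForm_eq {w : List b.support} {σ : P.weylGroup}
    (hw : IsReducedWord b w σ) (i : b.support) :
    ∃ n : ℕ, heightForm b (fundamentalWeight b i - σ • fundamentalWeight b i) = n ∧
      (i ∈ w → 0 < n) := by
  obtain rfl := hw.1
  induction w using List.reverseRecOn with
  | nil => exact ⟨0, by simp, by simp⟩
  | append_singleton w j ih =>
    obtain ⟨n, hn, hpos⟩ := ih hw.left
    rw [wordProd_append, wordProd_singleton, mul_smul, simpleReflection_smul_fundamentalWeight]
    split_ifs with hij
    · have hj := hw.isPos
      rw [Base.isPos_iff] at hj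
      obtain ⟨m, hm⟩ := Int.eq_ofNat_of_zero_le hj.le
      refine ⟨n + m, ?_, fun _ ↦ by lia⟩
      rw [smul_sub, ← sub_add, map_add, hn, ← root_smul, heightForm_root, hm]
      push_cast
      rfl
    · rw [sub_zero]
      refine ⟨n, hn, fun hi ↦ hpos ?_⟩
      simpa [Ne.symm hij] using hi

/-- The influence of `σ` consists of the indices whose fundamental weight `σ` moves. In
particular a letter that some word for `σ` avoids occurs in no reduced word for `σ`. -/
lemma mem_influence_iff {σ : P.weylGroup} {i : b.support} :
    i ∈ influence b σ ↔ σ • fundamentalWeight b i ≠ fundamentalWeight b i := by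
  constructor
  · rintro ⟨w, hw, hi⟩ hfix
    obtain ⟨n, hn, hpos⟩ := hw.exists_heightForm_eq i
    rw [hfix, sub_self, map_zero, eq_comm, Nat.cast_eq_zero] at hn
    exact (hpos hi).ne' hn
  · intro h
    obtain ⟨w, hw⟩ := exists_isReducedWord b σ
    refine ⟨w, hw, ?_⟩
    contrapose! h
    rw [← hw.1]
    exact wordProd_smul_fundamentalWeight_of_notMem h

lemma influence_one : influence b (1 : P.weylGroup) = ∅ := by
  ext i
  simp [mem_influence_iff]

lemma influence_mul_subset (σ τ : P.weylGroup) :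
    influence b (σ * τ) ⊆ influence b σ ∪ influence b τ := by
  intro i hi
  rw [mem_union]
  contrapose! hi
  simp only [mem_influence_iff, not_not] at hi ⊢
  rw [mul_smul, hi.2, hi.1]

lemma Independent.influence_mul {σ τ : P.weylGroup} (h : Independent b σ τ) :
    influence b (σ * τ) = influence b σ ∪ influence b τ := by
  have key {σ τ : P.weylGroup} (h : Independent b σ τ) :
      influence b σ ⊆ influence b (σ * τ) := by
    intro i hi
    have hτ : i ∉ influence b τ := fun hi' ↦ (independent_iff.1 h i hi i hi').1 rfl
    rw [mem_influence_iff] at hi ⊢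
    rw [mem_influence_iff, not_not] at hτ
    rwa [mul_smul, hτ]
  refine (influence_mul_subset σ τ).antisymm (union_subset (key h) ?_)
  rw [h.commute.eq]
  exact key h.symm

lemma influence_list_prod_subset {l : List P.weylGroup} {i : b.support}
    (hi : i ∈ influence b l.prod) : ∃ ν ∈ l, i ∈ influence b ν := by
  induction l with
  | nil => simp [influence_one] at hi
  | cons σ l ih =>
    rw [List.prod_cons] at hi
    rcases influence_mul_subset _ _ hi with hi | hi
    · exact ⟨σ, by simp, hi⟩
    · obtain ⟨ν, hν, hi⟩ := ih hi
      exact ⟨ν, by simp [hν], hi⟩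

/-- The influence of a product of two nontrivial independent elements is disconnected. -/
lemma Independent.not_hasConnectedInfluence_mul {σ τ : P.weylGroup} (h : Independent b σ τ)
    (hσ : (influence b σ).Nonempty) (hτ : (influence b τ).Nonempty) :
    ¬ HasConnectedInfluence b (σ * τ) := by
  intro hc
  obtain ⟨i, hi⟩ := hσ
  obtain ⟨j, hj⟩ := hτ
  rw [independent_iff] at h
  have hI := Independent.influence_mul (independent_iff.2 h)
  -- A walk in the influence that starts in `I(σ)` never leaves it.
  have hwalk (u v : influence b (σ * τ))
      (p : ((dynkinGraph b).induce (influence b (σ * τ))).Walk u v) :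
      (u : b.support) ∈ influence b σ → (v : b.support) ∈ influence b σ := by
    induction p with
    | nil => exact id
    | @cons u v w huv _ ih =>
      intro hu
      refine ih ?_
      rcases hI.subset v.2 with hv | hv
      · exact hv
      · exact absurd huv (h u hu v hv).2
  obtain ⟨p⟩ := hc.preconnected ⟨i, hI.superset <| Or.inl hi⟩ ⟨j, hI.superset <| Or.inr hj⟩
  exact (h j (hwalk _ _ p hi) j hj).1 rfl

variable {x y : M} {S T : Set P.weylGroup}

/-- An independent product with connected influence has a single factor. -/
lemma IsIndependentProduct.mem_of_hasConnectedInfluence {σ : P.weylGroup} {l : List P.weylGroup}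
    (hS : ∀ ν ∈ S, HasConnectedInfluence b ν) (h : IsIndependentProduct b S l σ)
    (hσ : HasConnectedInfluence b σ) : σ ∈ S := by
  obtain ⟨hnd, hmem, hpw, rfl⟩ := h
  match l with
  | [] =>
    obtain ⟨i, hi⟩ := hσ.nonempty
    simp [influence_one] at hi
  | [ν] => simpa using hmem ν
  | ν :: τ :: l =>
    exfalso
    have hind (κ) (hκ : κ ∈ τ :: l) : Independent b ν κ :=
      hpw (by simp) (List.mem_cons_of_mem _ hκ) (by rintro rfl; exact (List.nodup_cons.1 hnd).1 hκ)
    have hprod : Independent b ν (τ :: l).prod := by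
      rw [independent_iff]
      intro i hi j hj
      obtain ⟨κ, hκ, hj⟩ := influence_list_prod_subset hj
      exact independent_iff.1 (hind κ hκ) i hi j hj
    have hτl : Independent b τ l.prod := by
      rw [independent_iff]
      intro i hi j hj
      obtain ⟨κ, hκ, hj⟩ := influence_list_prod_subset hj
      refine independent_iff.1 (hpw (by simp) (by simp [hκ]) ?_) i hi j hj
      rintro rfl
      exact (List.nodup_cons.1 (List.nodup_cons.1 hnd).2).1 hκ
    refine hprod.not_hasConnectedInfluence_mul (hS ν (hmem ν (by simp))).nonempty ?_ hσ
    rw [List.prod_cons, hτl.influence_mul]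
    exact (hS τ (hmem τ (by simp))).nonempty.inl

/-- An element of `S` lies in the alternation set, so it is an independent product over `T`, and its
connected influence leaves a single factor. -/
lemma IsBAS.subset_of_isBAS (hS : IsBAS b x y S) (hT : IsBAS b x y T) : S ⊆ T := fun σ hσ ↦
  let ⟨_, hl⟩ := hT.exists_prod σ (hS.subset hσ)
  hl.mem_of_hasConnectedInfluence hT.connected (hS.connected σ hσ)

lemma IsBAS.eq (hS : IsBAS b x y S) (hT : IsBAS b x y T) : S = T :=
  (hS.subset_of_isBAS hT).antisymm (hT.subset_of_isBAS hS)

lemma IsBAS.bas_eq (hS : IsBAS b x y S) : BAS b x y = S :=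
  IsBAS.eq (Classical.epsilon_spec ⟨S, hS⟩) hS

end Influence

end WeylAlternation

end

theorem mainTheorem3 {𝔤 : Type*} [LieRing 𝔤] [LieAlgebra ℂ 𝔤] [FiniteDimensional ℂ 𝔤]
    [LieAlgebra.IsSimple ℂ 𝔤]
    (𝔥 : LieSubalgebra ℂ 𝔤) [𝔥.IsCartanSubalgebra]
    (b : (LieAlgebra.IsKilling.rootSystem 𝔥).Base)
    (lam mu : Module.Dual ℂ 𝔥)
    (hlam : WeylAlternation.IsDominantIntegral b lam)
    (hne : (WeylAlternation.alternationSet b lam mu).Nonempty)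
    (S : Set (LieAlgebra.IsKilling.rootSystem 𝔥).weylGroup)
    (hS : S ⊆ WeylAlternation.alternationSet b lam mu)
    (hone : 1 ∉ S)
    (hC1 : ∀ i : b.support,
      WeylAlternation.simpleReflection b i ∈ WeylAlternation.alternationSet b lam mu →
        WeylAlternation.simpleReflection b i ∈ S)
    (hC2 : ∀ σ ∈ S, WeylAlternation.HasConnectedInfluence b σ)
    (hC3 : ∀ σ ∈ S, ∀ τ ∈ S, ¬ WeylAlternation.Independent b σ τ →
      σ * τ ∈ S ∨
      (∃ l, WeylAlternation.IsIndependentProduct b S l (σ * τ) ∧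
        (l.map (WeylAlternation.length b)).sum <
          WeylAlternation.length b σ + WeylAlternation.length b τ) ∨
      WeylAlternation.ProductHasSubwordOutside b
        (WeylAlternation.alternationSet b lam mu) σ τ) :
    (∃! T, WeylAlternation.IsBAS b lam mu T) ∧ WeylAlternation.BAS b lam mu = S := by
  have hBAS : WeylAlternation.IsBAS b lam mu S :=
    ⟨hS, hone, hC2, fun _ hσ ↦ WeylAlternation.exists_isIndependentProduct hlam hC1 hC2 hC3 hσ⟩
  exact ⟨⟨S, hBAS, fun _ hT ↦ hT.eq hBAS⟩, hBAS.bas_eq⟩
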